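/- Let $f,g_1,\dots,g_m:\mathbb R^n\to\mathbb R^n$ with $f(0)=0$, and consider the control-affine system $\dot x=f_c(x,u):=f(x)+\sum_{i=1}^m g_i(x)u_i$, $x\in\mathbb R^n$, $u\in\mathbb R^m$. Assume that $f_c$ is continuous and that, for every $u$, $f_c(\cdot,u)$ is Lipschitz on some neighbourhood of the origin. Let $\Delta t>0$ be a sampling period over which the sampled dynamics are defined: for every constant input $\bar u$ and every initial state the system has a solution on $[0,\Delta t]$, and every solution on an interval $[0,s)$, $0<s\le\Delta t$, extends to a solution on $[0,\Delta t]$. Let $N\ge n$ and let $\Phi:\mathbb R^n\to\mathbb R^N$ be a locally Lipschitz lifting whose first $n$ components are the state, $\Phi(x)=(x,\phi_{n+1}(x),\dots,\phi_N(x))$. Let $A\in\mathbb R^{N\times N}$, $B_0\in\mathbb R^{N\times m}$, $\tilde B\in\mathbb R^{N\times mN}$ and $r:\mathbb R^n\times\mathbb R^m\to\mathbb R^N$ be such that every solution $x(\cdot)$ on $[0,\Delta t]$ under a constant input $\bar u$ satisfies $$\Phi(x(\Delta t))=A\Phi(x(0))+B_0\bar u+\tilde B(\bar u\otimes\Phi(x(0)))+r(x(0),\bar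 u)$$ (for example the surrogate model identified from data by SafEDMD), and suppose that, for some $c_x,c_u>0$, $\|r(x,u)\|\le c_x\|\Phi(x)\|+c_u\|u\|$ for all $x\in\mathbb R^n$, $u\in\mathbb R^m$. A symmetric $p\times p$ matrix $S$ of real polynomials in $z\in\mathbb R^N$ is in $\mathrm{SOS}[z,2\alpha]^p$ if $S=T^\top T$ for a $q\times p$ matrix $T$ (some $q$) of polynomials of degree at most $\alpha$, and in $\mathrm{SOS}_+[z,2\alpha]^p$ if $S-\varepsilon I\in\mathrm{SOS}[z,2\alpha]^p$ for some $\varepsilon>0$; the exponent is omitted for $p=1$. Suppose there are an integer $\alpha>0$, $P=P^\top\succ0$ in $\mathbb R^{N\times N}$, an $m\times N$ matrix $L_{\mathrm n}$ of polynomials in $z$ of degree at most $2\alpha-1$, $\tau,u_{\mathrm d}\in\mathrm{SOS}_+[z,2\alpha]$ and $\rho>0$ such that $$\begin{bmatrix}u_{\mathrm d}(z)P-\tau(z)I_N&0&0&u_{\mathrm d}(z)AP+B_0L_{\mathrm n}(z)+\tilde B(L_{\mathrm n}(z)\otimes z)\\ \star&\frac{\tau(z)}{2c_x^2}I_N&0&u_{\mathrm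 d}(z)P\\ \star&\star&\frac{\tau(z)}{2c_u^2}I_m&L_{\mathrm n}(z)\\ \star&\star&\star&u_{\mathrm d}(z)(P-\rho I_N)\end{bmatrix}\in\mathrm{SOS}[z,2\alpha]^{3N+m}.$$ Then the sampled controller $u(t)=\mu(x(k\Delta t))$ for $t\in[k\Delta t,(k+1)\Delta t)$, $k\ge0$, with $\mu(x)=\frac1{u_{\mathrm d}(\Phi(x))}L_{\mathrm n}(\Phi(x))P^{-1}\Phi(x)$, globally exponentially stabilizes the origin of the continuous-time system, in the following sense. From every $x(0)\in\mathbb R^n$ there is a closed-loop trajectory on $[0,\infty)$, and there is one rate $\gamma>0$ such that: 1. there is $C$ with $\|\Phi(x(k\Delta t))\|\le Ce^{-\gamma k\Delta t}\|\Phi(x(0))\|$ for all closed-loop trajectories and all $k\in\mathbb N_0$; 2. for every $R$ there is $C_R$ with $\|x(t)\|\le C_Re^{-\gamma t}\|x(0)\|$ for all $t\ge0$ and all closed-loop trajectories with $\|x(0)\|\le R$; 3. if, in addition, for some $\ell$ one has $\|\Phi(x)\|\le\ell\|x\|$ and $\|f_c(x,u)\|\le\ell(\|x\|+\|u\|)$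 for all $x,u$, then there is $C$ with $\|x(t)\|\le Ce^{-\gamma t}\|x(0)\|$ for all $t\ge0$ and all closed-loop trajectories. -/

import Mathlib

open Set Filter Topology

/-- `S = Tᵀ T` for some (possibly rectangular) polynomial matrix `T` all of whose entries have
degree at most `d`; that is, `S` is an SOS matrix, `S ∈ SOS[z, 2d]`. -/
def IsSOSMatrix {σ ι : Type} [Fintype ι] (d : ℕ) (S : Matrix ι ι (MvPolynomial σ ℝ)) : Prop :=
  ∃ (q : ℕ) (T : Matrix (Fin q) ι (MvPolynomial σ ℝ)),
    (∀ i j, (T i j).totalDegree ≤ d) ∧ S = T.transpose * T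

/-- `S - ε I` is an SOS matrix for some `ε > 0`, that is, `S ∈ SOS₊[z, 2d]`. -/
def IsStrictlySOSMatrix {σ ι : Type} [Fintype ι] [DecidableEq ι] (d : ℕ)
    (S : Matrix ι ι (MvPolynomial σ ℝ)) : Prop :=
  ∃ ε : ℝ, 0 < ε ∧
    IsSOSMatrix d (S - (MvPolynomial.C ε : MvPolynomial σ ℝ) • (1 : Matrix ι ι (MvPolynomial σ ℝ)))

/-- A strictly SOS scalar polynomial: the case of `1 × 1` matrices. -/
def IsStrictlySOS {σ : Type} (d : ℕ) (p : MvPolynomial σ ℝ) : Prop :=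
  IsStrictlySOSMatrix d (Matrix.of fun _ _ : Fin 1 => p)

/-- The Kronecker product `u ⊗ z` of two column vectors, indexed by pairs. -/
def kronVec {m N : ℕ} (u : Fin m → ℝ) (z : Fin N → ℝ) : Fin m × Fin N → ℝ :=
  fun p => u p.1 * z p.2

/-- The Kronecker product `L(z) ⊗ z` of a polynomial `m × N` matrix `L` with the column vector `z`
of the indeterminates, an `mN × N` matrix. -/
noncomputable def kronIndet {m N : ℕ} (L : Matrix (Fin m) (Fin N) (MvPolynomial (Fin N) ℝ)) :
    Matrix (Fin m × Fin N) (Fin N) (MvPolynomial (Fin N) ℝ) :=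
  Matrix.of fun p l => L p.1 l * MvPolynomial.X p.2

/-- A real matrix as a constant polynomial matrix. -/
noncomputable def constMat {N : ℕ} {κ ι : Type} (M : Matrix κ ι ℝ) :
    Matrix κ ι (MvPolynomial (Fin N) ℝ) :=
  M.map (MvPolynomial.C : ℝ →+* MvPolynomial (Fin N) ℝ)

/-- The symmetric polynomial matrix of size `3N + m`
```
  u_d P - τ I       0              0           u_d A P + B₀ L + B̃ (L ⊗ z)
      ⋆        τ/(2 c_x²) I        0           u_d P
      ⋆             ⋆         τ/(2 c_u²) I     L
      ⋆             ⋆              ⋆           u_d (P - ρ I)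
```
in the indeterminate `z`. -/
noncomputable def designMatrix {m N : ℕ} (A : Matrix (Fin N) (Fin N) ℝ)
    (B₀ : Matrix (Fin N) (Fin m) ℝ) (Bt : Matrix (Fin N) (Fin m × Fin N) ℝ) (cx cu : ℝ)
    (P : Matrix (Fin N) (Fin N) ℝ) (L : Matrix (Fin m) (Fin N) (MvPolynomial (Fin N) ℝ))
    (τ ud : MvPolynomial (Fin N) ℝ) (ρ : ℝ) :
    Matrix (((Fin N ⊕ Fin N) ⊕ Fin m) ⊕ Fin N) (((Fin N ⊕ Fin N) ⊕ Fin m) ⊕ Fin N)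
      (MvPolynomial (Fin N) ℝ) :=
  let diag : Matrix ((Fin N ⊕ Fin N) ⊕ Fin m) ((Fin N ⊕ Fin N) ⊕ Fin m)
      (MvPolynomial (Fin N) ℝ) :=
    Matrix.fromBlocks
      (Matrix.fromBlocks
        (ud • constMat P - τ • (1 : Matrix (Fin N) (Fin N) (MvPolynomial (Fin N) ℝ))) 0
        0 ((MvPolynomial.C (1 / (2 * cx ^ 2)) * τ) •
            (1 : Matrix (Fin N) (Fin N) (MvPolynomial (Fin N) ℝ))))
      0
      0 ((MvPolynomial.C (1 / (2 * cu ^ 2)) * τ) •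
          (1 : Matrix (Fin m) (Fin m) (MvPolynomial (Fin N) ℝ)))
  let col : Matrix ((Fin N ⊕ Fin N) ⊕ Fin m) (Fin N) (MvPolynomial (Fin N) ℝ) :=
    Matrix.fromRows
      (Matrix.fromRows
        (ud • constMat (A * P) + constMat B₀ * L + constMat Bt * kronIndet L)
        (ud • constMat P))
      L
  Matrix.fromBlocks diag col col.transpose
    (ud • constMat (P - ρ • (1 : Matrix (Fin N) (Fin N) ℝ)))

/-- The control-affine vector field `f_c(x, u) = f(x) + ∑ᵢ uᵢ gᵢ(x)`. -/
noncomputable def controlAffine {n m : ℕ}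
    (f : EuclideanSpace ℝ (Fin n) → EuclideanSpace ℝ (Fin n))
    (g : Fin m → EuclideanSpace ℝ (Fin n) → EuclideanSpace ℝ (Fin n))
    (x : EuclideanSpace ℝ (Fin n)) (u : EuclideanSpace ℝ (Fin m)) : EuclideanSpace ℝ (Fin n) :=
  f x + ∑ i, u i • g i x

/-- `ξ` solves `ẋ = F(x, u)` on the time set `I` under the constant input `u`
(one-sided derivatives at end points of `I`). -/
def SolvesConstInput {X U : Type} [NormedAddCommGroup X] [NormedSpace ℝ X]
    (F : X → U → X) (u : U) (I : Set ℝ) (ξ : ℝ → X) : Prop :=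
  IsIntegralCurveOn ξ (fun _ x => F x u) I

/-- Under every constant input and from every initial value, `ẋ = F(x, u)` is solvable on `[0, T]`
and no solution ceases to exist before or at time `T`: every solution on some `[0, s)`, `s ≤ T`,
extends to a solution on `[0, T]`. -/
def CompleteOverPeriod {X U : Type} [NormedAddCommGroup X] [NormedSpace ℝ X]
    (F : X → U → X) (T : ℝ) : Prop :=
  ∀ (u : U) (x₀ : X),
    (∃ ξ : ℝ → X, ξ 0 = x₀ ∧ SolvesConstInput F u (Icc 0 T) ξ) ∧
    ∀ s ∈ Ioc (0 : ℝ) T, ∀ ξ : ℝ → X, ξ 0 = x₀ → SolvesConstInput F u (Ico 0 s) ξ →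
      ∃ ξ' : ℝ → X, EqOn ξ' ξ (Ico 0 s) ∧ SolvesConstInput F u (Icc 0 T) ξ'

/-- `ξ` is a trajectory on `[0, ∞)` of `ẋ = F(x, u)` under the sample-and-hold feedback
`u(t) = μ(x(k T))` for `t ∈ [k T, (k+1) T)`. -/
def SampledTrajectory {X U : Type} [NormedAddCommGroup X] [NormedSpace ℝ X]
    (F : X → U → X) (μ : X → U) (T : ℝ) (ξ : ℝ → X) : Prop :=
  ∀ k : ℕ, SolvesConstInput F (μ (ξ (k * T))) (Icc (k * T) ((k + 1) * T)) ξ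

/-- The right-hand side `A z + B₀ u + B̃ (u ⊗ z)` of the lifted bilinear model. -/
noncomputable def bilinearModel {m N : ℕ} (A : Matrix (Fin N) (Fin N) ℝ)
    (B₀ : Matrix (Fin N) (Fin m) ℝ) (Bt : Matrix (Fin N) (Fin m × Fin N) ℝ)
    (z : EuclideanSpace ℝ (Fin N)) (u : EuclideanSpace ℝ (Fin m)) : EuclideanSpace ℝ (Fin N) :=
  WithLp.toLp 2 (A.mulVec z.ofLp + B₀.mulVec u.ofLp + Bt.mulVec (kronVec u.ofLp z.ofLp))

/-- The state feedback `μ(x) = L(Φ(x)) P⁻¹ Φ(x) / u_d(Φ(x))`. -/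
noncomputable def rationalController {n m N : ℕ}
    (Φ : EuclideanSpace ℝ (Fin n) → EuclideanSpace ℝ (Fin N))
    (P : Matrix (Fin N) (Fin N) ℝ) (L : Matrix (Fin m) (Fin N) (MvPolynomial (Fin N) ℝ))
    (ud : MvPolynomial (Fin N) ℝ) (x : EuclideanSpace ℝ (Fin n)) : EuclideanSpace ℝ (Fin m) :=
  WithLp.toLp 2 ((1 / MvPolynomial.eval (Φ x).ofLp ud) •
    (L.map (MvPolynomial.eval (Φ x).ofLp)).mulVec (P⁻¹.mulVec (Φ x).ofLp))

/-! Evaluated at a point z, the SOS certificate is a nonnegative quadratic form, and all facts about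
the controller come from testing this form on suitable vectors. The vector in `lyapunov_decrease`
does the work of a Schur complement and an S-procedure at once: it absorbs the residual and leaves
V(z⁺) ≤ V(z) - ρ|P⁻¹z|² for V(z) = zᵀP⁻¹z. As V(z) ≤ p|P⁻¹z|² for some p, V contracts by a fixed
factor per period, so the lifted state decays exponentially at the sampling instants. Two further
vectors, in `exists_gain_bound`, give |L(z)w| ≤ C u_d(z)|w|, hence |μ(x)| ≤ C'|Φ(x)|.

Between samples the state must be bounded by a multiple of its value at the last sample. Near the
origin this is Grönwall's estimate. Away from the origin any bound uniform on bounded sets is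
enough, and `CompleteOverPeriod.exists_norm_le` provides it by compactness: solutions that became
unbounded would have a limit solution up to the escape time, and its extension beyond that time
keeps them bounded after all. Solutions need not be unique, so every estimate holds for all of them.

That Φ(0) = 0 is a consequence of the decay. With it, Φ is linearly bounded on bounded sets, and
decay of Φ(x) turns into decay of x because x is a block of Φ(x). -/

/-! ### Pointwise evaluation of the SOS condition -/

open Matrix in
/-- An SOS matrix is positive semidefinite at every point. -/
theorem IsSOSMatrix.quadForm_nonneg {σ ι : Type} [Fintype ι] {d : ℕ}
    {S : Matrix ι ι (MvPolynomial σ ℝ)} (h : IsSOSMatrix d S) (z : σ → ℝ) (v : ι → ℝ) :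
    0 ≤ v ⬝ᵥ (S.map (MvPolynomial.eval z)) *ᵥ v := by
  obtain ⟨q, T, -, rfl⟩ := h
  rw [Matrix.map_mul, Matrix.transpose_map, ← Matrix.mulVec_mulVec, Matrix.mulVec_transpose,
    dotProduct_comm, ← Matrix.dotProduct_mulVec]
  exact Finset.sum_nonneg fun i _ => mul_self_nonneg _

open Matrix in
/-- A strictly SOS polynomial is everywhere positive. -/
theorem IsStrictlySOS.eval_pos {σ : Type} {d : ℕ} {p : MvPolynomial σ ℝ} (h : IsStrictlySOS d p)
    (z : σ → ℝ) : 0 < MvPolynomial.eval z p := by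
  obtain ⟨ε, hε, h⟩ := h
  have := h.quadForm_nonneg z (fun _ => 1)
  simp [dotProduct, Matrix.mulVec] at this
  linarith

open Matrix in
theorem constMat_map_eval {N : ℕ} {κ ι : Type} (M : Matrix κ ι ℝ) (z : Fin N → ℝ) :
    (constMat M : Matrix κ ι (MvPolynomial (Fin N) ℝ)).map (MvPolynomial.eval z) = M := by
  ext i j
  simp [constMat]

-- The mixed-product rule (L ⊗ z)e = (Le) ⊗ z; through it the B̃-block of the certificate becomes
-- the bilinear term of the closed loop.
open Matrix in
theorem kronIndet_map_eval_mulVec {m N : ℕ} (L : Matrix (Fin m) (Fin N) (MvPolynomial (Fin N) ℝ))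
    (z e : Fin N → ℝ) :
    ((kronIndet L).map (MvPolynomial.eval z)) *ᵥ e =
      kronVec ((L.map (MvPolynomial.eval z)) *ᵥ e) z := by
  ext p
  simp [kronIndet, kronVec, Matrix.mulVec, dotProduct, Finset.sum_mul]
  exact Finset.sum_congr rfl fun _ _ => by ring

open Matrix in
theorem map_eval_smul {N : ℕ} {κ ι : Type} (p : MvPolynomial (Fin N) ℝ)
    (M : Matrix κ ι (MvPolynomial (Fin N) ℝ)) (z : Fin N → ℝ) :
    (p • M).map (MvPolynomial.eval z) =
      MvPolynomial.eval z p • M.map (MvPolynomial.eval z) := by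
  ext i j
  simp

open Matrix in
theorem map_eval_one {N : ℕ} {ι : Type} [DecidableEq ι] (z : Fin N → ℝ) :
    (1 : Matrix ι ι (MvPolynomial (Fin N) ℝ)).map (MvPolynomial.eval z) = 1 :=
  Matrix.map_one _ (map_zero _) (map_one _)

open Matrix in
theorem map_eval_fromRows {N : ℕ} {κ κ' ι : Type} (M : Matrix κ ι (MvPolynomial (Fin N) ℝ))
    (M' : Matrix κ' ι (MvPolynomial (Fin N) ℝ)) (z : Fin N → ℝ) :
    (Matrix.fromRows M M').map (MvPolynomial.eval z) =
      Matrix.fromRows (M.map (MvPolynomial.eval z)) (M'.map (MvPolynomial.eval z)) := by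
  ext (i | i) j <;> simp

/-- `designMatrix` with its products written out (elaboration of its definition picks the `HMul`
instance of `CStarMatrix`, which agrees with that of `Matrix` definitionally). -/
theorem designMatrix_eq {m N : ℕ} (A : Matrix (Fin N) (Fin N) ℝ)
    (B₀ : Matrix (Fin N) (Fin m) ℝ) (Bt : Matrix (Fin N) (Fin m × Fin N) ℝ) (cx cu : ℝ)
    (P : Matrix (Fin N) (Fin N) ℝ) (L : Matrix (Fin m) (Fin N) (MvPolynomial (Fin N) ℝ))
    (τ ud : MvPolynomial (Fin N) ℝ) (ρ : ℝ) :
    let BL : Matrix (Fin N) (Fin N) (MvPolynomial (Fin N) ℝ) :=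
      Matrix.of fun i l => ∑ k, constMat B₀ i k * L k l
    let BtL : Matrix (Fin N) (Fin N) (MvPolynomial (Fin N) ℝ) :=
      Matrix.of fun i l => ∑ k, constMat Bt i k * kronIndet L k l
    let col : Matrix ((Fin N ⊕ Fin N) ⊕ Fin m) (Fin N) (MvPolynomial (Fin N) ℝ) :=
      Matrix.fromRows
        (Matrix.fromRows (ud • constMat (A * P) + BL + BtL) (ud • constMat P)) L
    designMatrix A B₀ Bt cx cu P L τ ud ρ =
      Matrix.fromBlocks
        (Matrix.fromBlocks
          (Matrix.fromBlocks (ud • constMat P - τ • 1) 0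
            0 ((MvPolynomial.C (1 / (2 * cx ^ 2)) * τ) • 1))
          0 0 ((MvPolynomial.C (1 / (2 * cu ^ 2)) * τ) • 1))
        col col.transpose (ud • constMat (P - ρ • 1)) :=
  rfl

-- This is the certificate at z tested on the stacked vector (a, b, c, e). The last block enters the
-- input terms only through Le, so a choice of e that makes Le a multiple of the control input
-- produces the closed-loop model in the a-row.
open Matrix in
theorem designMatrix_quadForm_nonneg {m N α : ℕ} {A : Matrix (Fin N) (Fin N) ℝ}
    {B₀ : Matrix (Fin N) (Fin m) ℝ} {Bt : Matrix (Fin N) (Fin m × Fin N) ℝ} {cx cu : ℝ}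
    {P : Matrix (Fin N) (Fin N) ℝ} {L : Matrix (Fin m) (Fin N) (MvPolynomial (Fin N) ℝ)}
    {τ ud : MvPolynomial (Fin N) ℝ} {ρ : ℝ}
    (h : IsSOSMatrix α (designMatrix A B₀ Bt cx cu P L τ ud ρ))
    (z a b e : Fin N → ℝ) (c : Fin m → ℝ) {d t : ℝ} (hd : MvPolynomial.eval z ud = d)
    (ht : MvPolynomial.eval z τ = t) {Le : Fin m → ℝ}
    (hLe : (L.map (MvPolynomial.eval z)) *ᵥ e = Le) :
    0 ≤ d * (a ⬝ᵥ P *ᵥ a) - t * (a ⬝ᵥ a) + t / (2 * cx ^ 2) * (b ⬝ᵥ b)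
      + t / (2 * cu ^ 2) * (c ⬝ᵥ c)
      + 2 * (a ⬝ᵥ (d • A *ᵥ (P *ᵥ e) + B₀ *ᵥ Le + Bt *ᵥ kronVec Le z))
      + 2 * (d * (b ⬝ᵥ P *ᵥ e)) + 2 * (c ⬝ᵥ Le) + d * (e ⬝ᵥ P *ᵥ e - ρ * (e ⬝ᵥ e)) := by
  have key := h.quadForm_nonneg z (Sum.elim (Sum.elim (Sum.elim a b) c) e)
  have hcol (M : Matrix ((Fin N ⊕ Fin N) ⊕ Fin m) (Fin N) ℝ) (x : (Fin N ⊕ Fin N) ⊕ Fin m → ℝ) :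
      e ⬝ᵥ Mᵀ *ᵥ x = x ⬝ᵥ M *ᵥ e := by
    rw [Matrix.mulVec_transpose, dotProduct_comm, ← Matrix.dotProduct_mulVec]
  have hsub (M M' : Matrix (Fin N) (Fin N) (MvPolynomial (Fin N) ℝ)) :
      (M - M').map (MvPolynomial.eval z) =
        M.map (MvPolynomial.eval z) - M'.map (MvPolynomial.eval z) :=
    Matrix.map_sub _ (map_sub _) _ _
  have hadd (M M' : Matrix (Fin N) (Fin N) (MvPolynomial (Fin N) ℝ)) :
      (M + M').map (MvPolynomial.eval z) =
        M.map (MvPolynomial.eval z) + M'.map (MvPolynomial.eval z) :=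
    Matrix.map_add _ (map_add _) _ _
  have hmul {κ : Type} [Fintype κ] (M : Matrix (Fin N) κ ℝ)
      (M' : Matrix κ (Fin N) (MvPolynomial (Fin N) ℝ)) :
      (Matrix.of fun i l => ∑ k, constMat M i k * M' k l).map (MvPolynomial.eval z) *ᵥ e =
        M *ᵥ (M'.map (MvPolynomial.eval z) *ᵥ e) := by
    rw [Matrix.mulVec_mulVec]
    congr 1
    ext i l
    simp [Matrix.mul_apply, constMat]
  simp only [designMatrix_eq, Matrix.fromBlocks_map, Matrix.transpose_map,
    Matrix.fromBlocks_mulVec, Sum.elim_comp_inl, Sum.elim_comp_inr, sumElim_dotProduct_sumElim,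
    dotProduct_add, hcol, map_eval_fromRows, Matrix.fromRows_mulVec, hsub, hadd, map_eval_smul,
    map_eval_one, constMat_map_eval, hmul, Matrix.map_zero _ (map_zero _),
    Matrix.zero_mulVec, Matrix.sub_mulVec, Matrix.add_mulVec,
    Matrix.smul_mulVec, Matrix.one_mulVec, dotProduct_sub, dotProduct_smul, map_mul,
    MvPolynomial.eval_C, hd, ht, ← Matrix.mulVec_mulVec, kronIndet_map_eval_mulVec, hLe,
    smul_eq_mul, add_zero, zero_add] at key
  convert key using 1
  simp only [dotProduct_add, dotProduct_smul, smul_eq_mul]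
  ring

/-! ### Quadratic forms, Lyapunov decrease and the gain bound -/

open Matrix in
/-- A quadratic form is bounded by a multiple of the sum of squares. -/
theorem exists_quadForm_le {ι : Type} [Fintype ι] (M : Matrix ι ι ℝ) :
    ∃ p : ℝ, 0 < p ∧ ∀ v : ι → ℝ, v ⬝ᵥ M *ᵥ v ≤ p * (v ⬝ᵥ v) := by
  refine ⟨1 + ∑ i, ∑ j, |M i j|, by positivity, fun v => ?_⟩
  have hv (i : ι) : v i ^ 2 ≤ v ⬝ᵥ v := by
    rw [sq]
    exact Finset.single_le_sum (f := fun i => v i * v i) (fun j _ => mul_self_nonneg _)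
      (Finset.mem_univ i)
  have hvv : 0 ≤ v ⬝ᵥ v := Finset.sum_nonneg fun i _ => mul_self_nonneg _
  have : v ⬝ᵥ M *ᵥ v ≤ (∑ i, ∑ j, |M i j|) * (v ⬝ᵥ v) := by
    generalize v ⬝ᵥ v = q at hv hvv
    simp only [dotProduct, Matrix.mulVec, Finset.mul_sum, Finset.sum_mul]
    refine Finset.sum_le_sum fun i _ => Finset.sum_le_sum fun j _ => ?_
    have h1 : |v i * v j| ≤ q := by
      rw [abs_le]
      constructor <;> nlinarith [hv i, hv j, sq_nonneg (v i + v j), sq_nonneg (v i - v j)]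
    calc v i * (M i j * v j) = M i j * (v i * v j) := by ring
      _ ≤ |M i j| * |v i * v j| := by rw [← abs_mul]; exact le_abs_self _
      _ ≤ |M i j| * q := by gcongr
  linarith

open Matrix in
theorem Matrix.PosDef.mulVec_inv_mulVec {ι : Type} [Fintype ι] [DecidableEq ι]
    {P : Matrix ι ι ℝ} (hP : P.PosDef) (z : ι → ℝ) : P *ᵥ (P⁻¹ *ᵥ z) = z := by
  rw [Matrix.mulVec_mulVec, Matrix.mul_nonsing_inv _ ((Matrix.isUnit_iff_isUnit_det _).1 hP.isUnit),
    Matrix.one_mulVec]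

open Matrix in
/-- The sum of squares is bounded by a multiple of the quadratic form of the inverse. -/
theorem Matrix.PosDef.dotProduct_self_le_inv_quadForm {ι : Type} [Fintype ι] [DecidableEq ι]
    {P : Matrix ι ι ℝ} (hP : P.PosDef) {p : ℝ} (hp : 0 < p)
    (h : ∀ v : ι → ℝ, v ⬝ᵥ P *ᵥ v ≤ p * (v ⬝ᵥ v)) (z : ι → ℝ) :
    z ⬝ᵥ z ≤ p * (z ⬝ᵥ P⁻¹ *ᵥ z) := by
  -- Expanding the form of P at this vector gives zᵀP⁻¹z - 2p⁻¹|z|² + p⁻²zᵀPz ≥ 0, and the last term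
  -- is at most p⁻¹|z|².
  have h0 := hP.posSemidef.dotProduct_mulVec_nonneg (P⁻¹ *ᵥ z - p⁻¹ • z)
  have hsymm : (P⁻¹ *ᵥ z) ⬝ᵥ P *ᵥ z = z ⬝ᵥ z := by
    rw [Matrix.dotProduct_mulVec, ← Matrix.mulVec_transpose]
    have : Pᵀ = P := by simpa using hP.isHermitian.eq
    rw [this, hP.mulVec_inv_mulVec]
  simp only [star_trivial, Matrix.mulVec_sub, Matrix.mulVec_smul, hP.mulVec_inv_mulVec,
    dotProduct_sub, sub_dotProduct, dotProduct_smul, smul_dotProduct, hsymm, smul_eq_mul,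
    dotProduct_comm (P⁻¹ *ᵥ z) z] at h0
  have h2 : p⁻¹ * (p⁻¹ * (z ⬝ᵥ P *ᵥ z)) ≤ p⁻¹ * (z ⬝ᵥ z) := by
    gcongr
    rw [inv_mul_le_iff₀ hp]
    exact h z
  have h3 : 0 ≤ z ⬝ᵥ P⁻¹ *ᵥ z - p⁻¹ * (z ⬝ᵥ z) := by linarith
  rw [sub_nonneg, inv_mul_le_iff₀ hp] at h3
  exact h3

open Matrix in
/-- Decrease of the Lyapunov function `zᵀ P⁻¹ z` along the perturbed bilinear closed loop. -/
theorem lyapunov_decrease {m N α : ℕ} {A : Matrix (Fin N) (Fin N) ℝ}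
    {B₀ : Matrix (Fin N) (Fin m) ℝ} {Bt : Matrix (Fin N) (Fin m × Fin N) ℝ} {cx cu : ℝ}
    {P : Matrix (Fin N) (Fin N) ℝ} {L : Matrix (Fin m) (Fin N) (MvPolynomial (Fin N) ℝ)}
    {τ ud : MvPolynomial (Fin N) ℝ} {ρ : ℝ}
    (h : IsSOSMatrix α (designMatrix A B₀ Bt cx cu P L τ ud ρ)) (hP : P.PosDef)
    (hτ : IsStrictlySOS α τ) (hud : IsStrictlySOS α ud) (hcx : 0 < cx) (hcu : 0 < cu)
    {z r zp : Fin N → ℝ} {u : Fin m → ℝ}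
    (hu : u = (1 / MvPolynomial.eval z ud) • (L.map (MvPolynomial.eval z)) *ᵥ (P⁻¹ *ᵥ z))
    (hzp : zp = A *ᵥ z + B₀ *ᵥ u + Bt *ᵥ kronVec u z + r)
    (hr : r ⬝ᵥ r ≤ 2 * cx ^ 2 * (z ⬝ᵥ z) + 2 * cu ^ 2 * (u ⬝ᵥ u)) :
    zp ⬝ᵥ P⁻¹ *ᵥ zp ≤ z ⬝ᵥ P⁻¹ *ᵥ z - ρ * ((P⁻¹ *ᵥ z) ⬝ᵥ (P⁻¹ *ᵥ z)) := by
  have hd := hud.eval_pos z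
  have ht := hτ.eval_pos z
  generalize hdd : MvPolynomial.eval z ud = d at *
  generalize htt : MvPolynomial.eval z τ = t at *
  set w := P⁻¹ *ᵥ z with hw
  have hPw : P *ᵥ w = z := hP.mulVec_inv_mulVec z
  set a := P⁻¹ *ᵥ zp with ha
  have hPa : P *ᵥ a = zp := hP.mulVec_inv_mulVec zp
  have hLe : (L.map (MvPolynomial.eval z)) *ᵥ (-w) = -(d • u) := by
    rw [hu, smul_smul, mul_one_div_cancel hd.ne', one_smul, Matrix.mulVec_neg]
  -- The blocks b and c minimise the form for a and e fixed; they contribute -(d²/t)(2c_x²|z|² +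
  -- 2c_u²|u|²), the budget for the residual.
  have key := designMatrix_quadForm_nonneg h z a ((2 * cx ^ 2 * (d / t)) • z) (-w)
    ((2 * cu ^ 2 * (d / t)) • u) hdd htt hLe
  have hk : kronVec (-(d • u)) z = -(d • kronVec u z) := by
    ext p
    simp [kronVec, mul_assoc]
  have hM : d • A *ᵥ (P *ᵥ (-w)) + B₀ *ᵥ (-(d • u)) + Bt *ᵥ kronVec (-(d • u)) z
      = -(d • (zp - r)) := by
    rw [hk, hzp]
    simp only [Matrix.mulVec_neg, Matrix.mulVec_smul, hPw, add_sub_cancel_right, smul_add, smul_neg]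
    abel
  -- Young's inequality 2d⟨a, r⟩ - t|a|² ≤ (d²/t)|r|²: the term -τI of the certificate pays for the
  -- residual.
  have hsq : 0 ≤ (t • a - d • r) ⬝ᵥ (t • a - d • r) :=
    Finset.sum_nonneg fun i _ => mul_self_nonneg _
  rw [hM] at key
  simp only [Matrix.mulVec_neg, hPw, hPa, dotProduct_neg, neg_dotProduct, dotProduct_smul,
    smul_dotProduct, smul_eq_mul, dotProduct_sub, sub_dotProduct, neg_neg,
    dotProduct_comm a zp, dotProduct_comm w z, dotProduct_comm r a] at key hsq
  generalize z ⬝ᵥ z = Z at *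
  generalize u ⬝ᵥ u = U at *
  generalize zp ⬝ᵥ a = Vp at *
  generalize a ⬝ᵥ a = S at *
  generalize a ⬝ᵥ r = ar at *
  generalize r ⬝ᵥ r = R at *
  generalize w ⬝ᵥ w = W at *
  generalize z ⬝ᵥ w = V at *
  have hS : 2 * d * ar - t * S ≤ d ^ 2 / t * R := by
    rw [div_mul_eq_mul_div, le_div_iff₀ ht]
    linarith
  have hR : d ^ 2 / t * R ≤ d ^ 2 / t * (2 * cx ^ 2 * Z + 2 * cu ^ 2 * U) := by gcongr
  have hx : t / (2 * cx ^ 2) * (2 * cx ^ 2 * (d / t) * (2 * cx ^ 2 * (d / t) * Z)) =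
      d ^ 2 / t * (2 * cx ^ 2 * Z) := by
    field_simp
  have hu' : t / (2 * cu ^ 2) * (2 * cu ^ 2 * (d / t) * (2 * cu ^ 2 * (d / t) * U)) =
      d ^ 2 / t * (2 * cu ^ 2 * U) := by
    field_simp
  rw [hx, hu'] at key
  have hfin : 0 ≤ d * (V - ρ * W - Vp) := by
    have e1 : d * (2 * cx ^ 2 * (d / t) * Z) = d ^ 2 / t * (2 * cx ^ 2 * Z) := by ring
    have e2 : 2 * cu ^ 2 * (d / t) * (d * U) = d ^ 2 / t * (2 * cu ^ 2 * U) := by ring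
    linarith
  linarith [(mul_nonneg_iff_of_pos_left hd).1 hfin]

open Matrix in
/-- The feedback gain is globally bounded. -/
theorem exists_gain_bound {m N α : ℕ} {A : Matrix (Fin N) (Fin N) ℝ}
    {B₀ : Matrix (Fin N) (Fin m) ℝ} {Bt : Matrix (Fin N) (Fin m × Fin N) ℝ} {cx cu : ℝ}
    {P : Matrix (Fin N) (Fin N) ℝ} {L : Matrix (Fin m) (Fin N) (MvPolynomial (Fin N) ℝ)}
    {τ ud : MvPolynomial (Fin N) ℝ} {ρ : ℝ} (hρ : 0 ≤ ρ)
    (h : IsSOSMatrix α (designMatrix A B₀ Bt cx cu P L τ ud ρ))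
    (hτ : IsStrictlySOS α τ) (hud : IsStrictlySOS α ud) (hcu : 0 < cu) :
    ∃ C : ℝ, 0 ≤ C ∧ ∀ z w : Fin N → ℝ,
      ((L.map (MvPolynomial.eval z)) *ᵥ w) ⬝ᵥ ((L.map (MvPolynomial.eval z)) *ᵥ w) ≤
        C * MvPolynomial.eval z ud ^ 2 * (w ⬝ᵥ w) := by
  obtain ⟨p, hp, hPp⟩ := exists_quadForm_le P
  refine ⟨p ^ 2 / (2 * cu ^ 2), by positivity, fun z w => ?_⟩
  have hd := hud.eval_pos z
  have ht := hτ.eval_pos z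
  generalize hdd : MvPolynomial.eval z ud = d at *
  generalize htt : MvPolynomial.eval z τ = t at *
  have hww : 0 ≤ w ⬝ᵥ w := Finset.sum_nonneg fun i _ => mul_self_nonneg _
  -- The first diagonal block bounds τ by a multiple of u_d.
  have h1 := designMatrix_quadForm_nonneg h z w 0 0 0 hdd htt (Matrix.mulVec_zero _)
  set Lw := (L.map (MvPolynomial.eval z)) *ᵥ w with hLw
  -- The two last blocks bound |Lw|² by a multiple of τ u_d |w|²; with the bound on τ this becomes
  -- u_d²|w|².
  have h2 := designMatrix_quadForm_nonneg h z 0 0 (-w) ((2 * cu ^ 2 / t) • Lw) hdd htt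
    (Matrix.mulVec_neg _ _)
  rw [← hLw] at h2
  have hk : kronVec (0 : Fin m → ℝ) z = 0 := by
    ext p
    simp [kronVec]
  simp only [hk, Matrix.mulVec_zero, dotProduct_zero, zero_dotProduct, mul_zero, add_zero, sub_zero,
    smul_zero, Matrix.mulVec_neg, dotProduct_neg, neg_dotProduct, dotProduct_smul, smul_dotProduct,
    smul_eq_mul, neg_neg, zero_add] at h1 h2
  have hPw := hPp w
  generalize w ⬝ᵥ w = W at *
  generalize Lw ⬝ᵥ Lw = Y at *
  generalize w ⬝ᵥ P *ᵥ w = Q at *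
  have h3 : 2 * cu ^ 2 / t * Y ≤ d * (p * W) := by
    have e1 : t / (2 * cu ^ 2) * (2 * cu ^ 2 / t * (2 * cu ^ 2 / t * Y)) = 2 * cu ^ 2 / t * Y := by
      field_simp
    have := mul_le_mul_of_nonneg_left hPw hd.le
    have := mul_nonneg hd.le (mul_nonneg hρ hww)
    linarith
  have h4 : t * W ≤ d * (p * W) := by
    have := mul_le_mul_of_nonneg_left hPw hd.le
    linarith
  rw [div_mul_eq_mul_div, div_le_iff₀ ht] at h3
  have h5 : 2 * cu ^ 2 * Y ≤ d * p * (d * (p * W)) := by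
    have := mul_le_mul_of_nonneg_left h4 (by positivity : 0 ≤ d * p)
    linarith
  rw [div_mul_eq_mul_div, div_mul_eq_mul_div, le_div_iff₀ (by positivity)]
  linarith

/-! ### Solutions under constant and sampled inputs -/

section SampledDynamics

variable {X U : Type} [NormedAddCommGroup X] [NormedSpace ℝ X]

theorem SolvesConstInput.mono {F : X → U → X} {u : U} {I J : Set ℝ} {ξ : ℝ → X}
    (h : SolvesConstInput F u J ξ) (hIJ : I ⊆ J) : SolvesConstInput F u I ξ :=
  IsIntegralCurveOn.mono h hIJ

theorem SolvesConstInput.continuousOn {F : X → U → X} {u : U} {I : Set ℝ} {ξ : ℝ → X}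
    (h : SolvesConstInput F u I ξ) : ContinuousOn ξ I :=
  IsIntegralCurveOn.continuousOn h

theorem SolvesConstInput.congr {F : X → U → X} {u : U} {I : Set ℝ} {ξ ζ : ℝ → X}
    (h : SolvesConstInput F u I ξ) (hζ : EqOn ζ ξ I) : SolvesConstInput F u I ζ := fun t ht => by
  have := (h t ht).congr hζ (hζ ht)
  rwa [← hζ ht] at this

theorem SolvesConstInput.comp_add_const {F : X → U → X} {u : U} {a b : ℝ} {ξ : ℝ → X}
    (h : SolvesConstInput F u (Icc a b) ξ) (c : ℝ) :
    SolvesConstInput F u (Icc (a - c) (b - c)) fun t => ξ (t + c) := fun t ht => by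
  have ht' : t + c ∈ Icc a b := ⟨by linarith [ht.1], by linarith [ht.2]⟩
  have hm : MapsTo (fun t => t + c) (Icc (a - c) (b - c)) (Icc a b) := fun τ hτ =>
    ⟨by linarith [hτ.1], by linarith [hτ.2]⟩
  have := (h (t + c) ht').scomp t ((hasDerivWithinAt_id t _).add_const c) hm
  simpa [Function.comp_def] using this

/-- A solution stays below a barrier which grows faster than the solution wherever they meet. -/
theorem SolvesConstInput.norm_le_of_barrier {F : X → U → X} {u : U} {a b : ℝ} {ξ : ℝ → X}
    (h : SolvesConstInput F u (Icc a b) ξ) {B B' : ℝ → ℝ} (hB : ∀ t, HasDerivAt B (B' t) t)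
    (ha : ‖ξ a‖ ≤ B a) (bound : ∀ t ∈ Ico a b, ‖ξ t‖ = B t → ‖F (ξ t) u‖ < B' t) :
    ∀ t ∈ Icc a b, ‖ξ t‖ ≤ B t := fun _ ht =>
  image_norm_le_of_norm_deriv_right_lt_deriv_boundary' (f' := fun t => F (ξ t) u) h.continuousOn
    (fun t ht => (h t (Ico_subset_Icc_self ht)).mono_of_mem_nhdsWithin (Icc_mem_nhdsGE_of_mem ht))
    ha (fun t _ => (hB t).continuousAt.continuousWithinAt) (fun t _ => (hB t).hasDerivWithinAt)
    bound ht

/-- A Grönwall estimate which needs the growth bound on a ball only. -/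
theorem SolvesConstInput.norm_le_exp {F : X → U → X} {u : U} {a b K c δ : ℝ} {ξ : ℝ → X}
    (h : SolvesConstInput F u (Icc a b) ξ) (hK : 0 ≤ K) (hc : 0 ≤ c)
    (hF : ∀ x, ‖x‖ ≤ δ → ‖F x u‖ ≤ K * ‖x‖ + c)
    (hδ : (‖ξ a‖ + c) * Real.exp ((K + 1) * (b - a)) < δ) :
    ∀ t ∈ Icc a b, ‖ξ t‖ ≤ (‖ξ a‖ + c) * Real.exp ((K + 1) * (b - a)) := by
  intro t ht
  set E := Real.exp ((K + 1) * (b - a)) with hE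
  have hE0 : 0 < E := Real.exp_pos _
  refine le_of_forall_pos_le_add fun ε hε => ?_
  -- The slack η makes the barrier strict at the start, yet keeps it below δ and within ε of the
  -- claimed bound. The rate K + 1 leaves a margin ‖ξ t‖ > c at a contact point, which beats the
  -- inhomogeneous term.
  set η := min ε (δ - (‖ξ a‖ + c) * E) / E with hη
  have hη0 : 0 < η := div_pos (lt_min hε (sub_pos.2 hδ)) hE0
  have hηE : η * E = min ε (δ - (‖ξ a‖ + c) * E) := div_mul_cancel₀ _ hE0.ne'
  have hexp : ∀ t ∈ Icc a b, Real.exp ((K + 1) * (t - a)) ≤ E := fun t ht => by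
    rw [hE]
    have := ht.2
    gcongr
  have hle : ∀ t ∈ Icc a b, (‖ξ a‖ + η + c) * Real.exp ((K + 1) * (t - a)) ≤
      (‖ξ a‖ + c) * E + min ε (δ - (‖ξ a‖ + c) * E) := fun t ht => by
    calc (‖ξ a‖ + η + c) * Real.exp ((K + 1) * (t - a)) ≤ (‖ξ a‖ + η + c) * E := by
          gcongr
          exact hexp t ht
      _ = (‖ξ a‖ + c) * E + η * E := by ring
      _ = _ := by rw [hηE]
  have hB (t : ℝ) : HasDerivAt (fun t => (‖ξ a‖ + η + c) * Real.exp ((K + 1) * (t - a)))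
      ((‖ξ a‖ + η + c) * (Real.exp ((K + 1) * (t - a)) * ((K + 1) * 1))) t :=
    ((((hasDerivAt_id t).sub_const a).const_mul (K + 1)).exp).const_mul _
  refine (h.norm_le_of_barrier hB (by simp; linarith) (fun t ht heq => ?_) t ht).trans
    ((hle t ht).trans (by gcongr; exact min_le_left _ _))
  have ht' := Ico_subset_Icc_self ht
  have hδt : ‖ξ t‖ ≤ δ := by
    have := min_le_right ε (δ - (‖ξ a‖ + c) * E)
    linarith [hle t ht']
  have h1 : 1 ≤ Real.exp ((K + 1) * (t - a)) :=
    Real.one_le_exp (mul_nonneg (by linarith) (sub_nonneg.2 ht.1))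
  have h2 : ‖ξ a‖ + η + c ≤ ‖ξ t‖ := by
    rw [heq]
    exact le_mul_of_one_le_right (by positivity) h1
  have h3 := hF _ hδt
  have h4 : (‖ξ a‖ + η + c) * (Real.exp ((K + 1) * (t - a)) * ((K + 1) * 1)) =
      (K + 1) * ‖ξ t‖ := by
    rw [heq]
    ring
  rw [h4]
  linarith [norm_nonneg (ξ a)]

/-- The mean value inequality for solutions. -/
theorem SolvesConstInput.norm_sub_sub_le {F : X → U → X} {u : U} {a b C : ℝ} {ξ : ℝ → X} {v : X}
    {I : Set ℝ} (hI : Convex ℝ I) (h : SolvesConstInput F u I ξ)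
    (hC : ∀ t ∈ I, ‖F (ξ t) u - v‖ ≤ C) (ha : a ∈ I) (hb : b ∈ I) :
    ‖ξ b - ξ a - (b - a) • v‖ ≤ C * |b - a| := by
  have := hI.norm_image_sub_le_of_norm_hasDerivWithin_le (f := fun t => ξ t - t • v)
    (f' := fun t => F (ξ t) u - v) (C := C) (fun t ht => by
      simpa using! (h t ht).sub ((hasDerivWithinAt_id t I).smul_const v)) hC ha hb
  rw [Real.norm_eq_abs] at this
  convert this using 2
  rw [sub_smul]
  abel

/-- Solvability over one sampling period yields sampled trajectories from every initial value. -/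
theorem CompleteOverPeriod.exists_sampledTrajectory {F : X → U → X} {T : ℝ}
    (hc : CompleteOverPeriod F T) (hT : 0 < T) (μ : X → U) (x₀ : X) :
    ∃ ξ, ξ 0 = x₀ ∧ SampledTrajectory F μ T ξ := by
  choose sol hsol0 hsol using fun x => (hc (μ x) x).1
  let x : ℕ → X := fun k => Nat.rec x₀ (fun _ y => sol y T) k
  let ξ : ℝ → X := fun t => sol (x ⌊t / T⌋₊) (t - ⌊t / T⌋₊ * T)
  have hξ (k : ℕ) : EqOn ξ (fun t => sol (x k) (t - k * T)) (Icc (k * T) ((k + 1) * T)) := by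
    intro t ht
    rcases ht.2.eq_or_lt with rfl | hlt
    -- At the right end point the floor already selects the next piece; its initial value is the end
    -- value of the current one, so the pieces fit.
    · have : ⌊((k : ℝ) + 1) * T / T⌋₊ = k + 1 := by
        rw [mul_div_cancel_right₀ _ hT.ne']
        exact_mod_cast Nat.floor_natCast (R := ℝ) (k + 1)
      simp only [ξ, this]
      push_cast
      rw [sub_self, hsol0, show ((k : ℝ) + 1) * T - k * T = T by ring]
    · have : ⌊t / T⌋₊ = k := by
        rw [Nat.floor_eq_iff (div_nonneg ((by positivity : 0 ≤ (k : ℝ) * T).trans ht.1) hT.le),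
          le_div_iff₀ hT, div_lt_iff₀ hT]
        exact ⟨ht.1, hlt⟩
      simp only [ξ, this]
  have hξk (k : ℕ) : ξ (k * T) = x k := by
    rw [hξ k ⟨le_rfl, by nlinarith⟩]
    simp [hsol0]
  refine ⟨ξ, by simpa [x] using hξk 0, fun k => ?_⟩
  rw [hξk]
  refine SolvesConstInput.congr ?_ (hξ k)
  have := (hsol (x k)).comp_add_const (-(k * T))
  convert this using 1
  · ring_nf
  · simp only [sub_eq_add_neg]

/-! ### Compactness: limits of solutions and bounded reachable tubes -/

theorem exists_norm_le_on_balls {X U Y : Type} [NormedAddCommGroup X] [ProperSpace X]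
    [NormedAddCommGroup U] [ProperSpace U] [SeminormedAddCommGroup Y] {F : X → U → Y}
    (hF : Continuous fun p : X × U => F p.1 p.2)
    (R : ℝ) : ∃ K : ℝ, 0 ≤ K ∧ ∀ x u, ‖x‖ ≤ R → ‖u‖ ≤ R → ‖F x u‖ ≤ K := by
  have hc := (isCompact_closedBall (0 : X) R).prod (isCompact_closedBall (0 : U) R)
  obtain ⟨K, hK⟩ := hc.exists_bound_of_continuousOn hF.continuousOn
  exact ⟨max K 0, le_max_right _ _, fun x u hx hu =>
    (hK (x, u) ⟨by simpa using hx, by simpa using hu⟩).trans (le_max_left _ _)⟩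

variable [ProperSpace X] [NormedAddCommGroup U] [ProperSpace U]

/-- A pointwise limit of locally bounded solutions is a solution. -/
theorem solvesConstInput_of_tendsto {ι : Type} {l : Filter ι} [l.NeBot] {F : X → U → X}
    (hF : Continuous fun p : X × U => F p.1 p.2) {u : ι → U} {u₀ : U} (hu : Tendsto u l (𝓝 u₀))
    {T s : ℝ} (hsT : s ≤ T) {ξ : ι → ℝ → X} (hξ : ∀ j, SolvesConstInput F (u j) (Icc 0 T) (ξ j))
    (hbdd : ∀ t ∈ Ico 0 s, ∃ B : ℝ, ∀ᶠ j in l, ∀ τ ∈ Icc 0 t, ‖ξ j τ‖ ≤ B) {ζ : ℝ → X}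
    (hζ : ∀ t ∈ Ico 0 s, Tendsto (fun j => ξ j t) l (𝓝 (ζ t))) :
    SolvesConstInput F u₀ (Ico 0 s) ζ := by
  intro a ha
  rw [hasDerivWithinAt_iff_isLittleO, Asymptotics.isLittleO_iff]
  intro c hc
  obtain ⟨t₁, hat₁, ht₁s⟩ := exists_between ha.2
  obtain ⟨B, hB⟩ := hbdd t₁ ⟨ha.1.trans hat₁.le, ht₁s⟩
  obtain ⟨M, hM0, hM⟩ := exists_norm_le_on_balls hF (max B (‖u₀‖ + 1))
  obtain ⟨δ, hδ, hcont⟩ := Metric.continuousAt_iff.1 (hF.continuousAt (x := (ζ a, u₀))) c hc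
  set v := F (ζ a) u₀
  have hsmall : ∀ᶠ x in 𝓝[Ico 0 s] a, M * |x - a| < δ / 2 := by
    have : Tendsto (fun x : ℝ => M * |x - a|) (𝓝 a) (𝓝 (M * |a - a|)) :=
      Continuous.tendsto (by fun_prop) a
    rw [sub_self, abs_zero, mul_zero] at this
    exact nhdsWithin_le_nhds (this.eventually (gt_mem_nhds (half_pos hδ)))
  filter_upwards [hsmall, self_mem_nhdsWithin, nhdsWithin_le_nhds (Iio_mem_nhds hat₁)]
    with x hx hxs hxt
  -- The difference-quotient estimate is a closed condition, so it suffices to prove it for the ξ j.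
  -- A common speed bound M keeps them within δ of ζ a near a, hence the vector field within c of v.
  refine le_of_tendsto (((hζ x hxs).sub (hζ a ha)).sub_const _).norm ?_
  have hu1 : ∀ᶠ j in l, ‖u j‖ ≤ ‖u₀‖ + 1 := by
    filter_upwards [hu.norm.eventually (ge_mem_nhds (lt_add_one ‖u₀‖))] with j hj using hj
  filter_upwards [hB, hu1, hu.eventually (Metric.ball_mem_nhds _ hδ),
    (hζ a ha).eventually (Metric.ball_mem_nhds _ (half_pos hδ))] with j hBj huj hujδ hja
  have hsub : uIcc a x ⊆ Icc 0 t₁ := uIcc_subset_Icc ⟨ha.1, hat₁.le⟩ ⟨hxs.1, le_of_lt hxt⟩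
  have hsol : SolvesConstInput F (u j) (uIcc a x) (ξ j) :=
    (hξ j).mono (hsub.trans (Icc_subset_Icc_right (ht₁s.le.trans hsT)))
  have hbound : ∀ τ ∈ uIcc a x, ‖F (ξ j τ) (u j)‖ ≤ M := fun τ hτ =>
    hM _ _ ((hBj τ (hsub hτ)).trans (le_max_left _ _)) (huj.trans (le_max_right _ _))
  refine hsol.norm_sub_sub_le (convex_uIcc a x) (fun τ hτ => ?_) left_mem_uIcc right_mem_uIcc
  have h1 : ‖ξ j τ - ξ j a‖ ≤ M * |τ - a| := by
    simpa using hsol.norm_sub_sub_le (v := 0) (convex_uIcc a x) (by simpa using hbound)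
      left_mem_uIcc hτ
  have h2 : |τ - a| ≤ |x - a| := abs_sub_left_of_mem_uIcc hτ
  have h3 : dist (ξ j τ) (ζ a) < δ := by
    calc dist (ξ j τ) (ζ a) ≤ dist (ξ j τ) (ξ j a) + dist (ξ j a) (ζ a) := dist_triangle _ _ _
      _ < δ / 2 + δ / 2 := by
          refine add_lt_add ?_ hja
          rw [dist_eq_norm]
          exact (h1.trans (mul_le_mul_of_nonneg_left h2 hM0)).trans_lt hx
      _ = δ := add_halves δ
  have := hcont (x := (ξ j τ, u j)) (by rw [Prod.dist_eq]; exact max_lt h3 hujδ)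
  rw [dist_eq_norm] at this
  exact this.le

/-- Completeness over the sampling period makes the reachable tube of bounded sets of initial values
and inputs bounded. -/
theorem CompleteOverPeriod.exists_norm_le {F : X → U → X} {T : ℝ} (hc : CompleteOverPeriod F T)
    (hT : 0 < T) (hF : Continuous fun p : X × U => F p.1 p.2) (R : ℝ) :
    ∃ B : ℝ, ∀ u ξ, ‖u‖ ≤ R → ‖ξ 0‖ ≤ R → SolvesConstInput F u (Icc 0 T) ξ →
      ∀ t ∈ Icc 0 T, ‖ξ t‖ ≤ B := by
  by_contra! hcon
  choose u ξ hu hξ0 hsol t ht hlt using fun j : ℕ => hcon j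
  -- Along an ultrafilter bounded families converge pointwise, so no subsequences need be extracted.
  let 𝒰 := hyperfilter ℕ
  obtain ⟨u₀, -, hu₀⟩ := (isCompact_closedBall (0 : U) R).ultrafilter_le_nhds' (𝒰.map u)
    (show ∀ᶠ j in (𝒰 : Filter ℕ), u j ∈ Metric.closedBall 0 R from
      Filter.Eventually.of_forall fun j => by simpa using hu j)
  have hu₀ : Tendsto u 𝒰 (𝓝 u₀) := hu₀
  let Good : ℝ → Prop := fun t => ∃ B : ℝ, ∀ᶠ j in (𝒰 : Filter ℕ), ∀ τ ∈ Icc 0 t, ‖ξ j τ‖ ≤ B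
  have good_mono {t t' : ℝ} (htt : t ≤ t') (h : Good t') : Good t :=
    h.imp fun B hB => hB.mono fun j hj τ hτ => hj τ ⟨hτ.1, hτ.2.trans htt⟩
  have good_zero : Good 0 := ⟨R, Filter.Eventually.of_forall fun j τ hτ => by
    obtain rfl : τ = 0 := le_antisymm hτ.2 hτ.1
    exact hξ0 j⟩
  -- The step length depends only on the bound M at time t, not on the bound over [0, t]. This
  -- uniformity lets a step cross the supremum s below.
  have good_step (M : ℝ) : ∃ h : ℝ, 0 < h ∧ ∀ t ∈ Icc 0 T, Good t →
      (∀ᶠ j in (𝒰 : Filter ℕ), ‖ξ j t‖ ≤ M) → Good (min (t + h) T) := by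
    obtain ⟨K, hK0, hK⟩ := exists_norm_le_on_balls hF (max (M + 1) R)
    refine ⟨1 / (K + 1), by positivity, fun t ht ⟨B, hB⟩ hM => ⟨max B (M + 1), ?_⟩⟩
    filter_upwards [hB, hM] with j hBj hMj τ hτ
    rcases le_total τ t with hτt | hτt
    · exact (hBj τ ⟨hτ.1, hτt⟩).trans (le_max_left _ _)
    refine le_trans ?_ (le_max_right _ _)
    have hle : ∀ τ ∈ Icc t (min (t + 1 / (K + 1)) T), M + (K + 1) * (τ - t) ≤ M + 1 := by
      intro τ hτ
      have h1 : τ - t ≤ 1 / (K + 1) := by linarith [hτ.2.trans (min_le_left _ _)]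
      rw [le_div_iff₀ (by positivity)] at h1
      linarith
    have hB' (τ : ℝ) : HasDerivAt (fun τ => M + (K + 1) * (τ - t)) ((K + 1) * 1) τ :=
      (((hasDerivAt_id τ).sub_const t).const_mul (K + 1)).const_add M
    have hs : SolvesConstInput F (u j) (Icc t (min (t + 1 / (K + 1)) T)) (ξ j) :=
      (hsol j).mono (Icc_subset_Icc ht.1 (min_le_right _ _))
    refine (hs.norm_le_of_barrier hB' (by simpa using hMj) (fun τ hτ heq => ?_) τ
      ⟨hτt, hτ.2⟩).trans (hle τ ⟨hτt, hτ.2⟩)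
    have := hK (ξ j τ) (u j)
      ((heq.trans_le (hle τ (Ico_subset_Icc_self hτ))).trans (le_max_left _ _))
      ((hu j).trans (le_max_right _ _))
    linarith
  set S := {t | t ∈ Icc 0 T ∧ Good t} with hS
  have hSb : BddAbove S := ⟨T, fun t ht => ht.1.2⟩
  have hS0 : (0 : ℝ) ∈ S := ⟨⟨le_rfl, hT.le⟩, good_zero⟩
  set s := sSup S with hs
  have hsT : s ≤ T := csSup_le ⟨0, hS0⟩ fun t ht => ht.1.2
  have hs0 : 0 < s := by
    obtain ⟨h, hh, hstep⟩ := good_step R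
    have hg := hstep 0 ⟨le_rfl, hT.le⟩ good_zero (Filter.Eventually.of_forall hξ0)
    rw [zero_add] at hg
    exact (lt_min hh hT).trans_le
      (le_csSup hSb ⟨⟨(lt_min hh hT).le, min_le_right _ _⟩, hg⟩)
  have good_lt : ∀ t ∈ Ico 0 s, Good t := fun t ht => by
    obtain ⟨t', ht', htt'⟩ := exists_lt_of_lt_csSup ⟨0, hS0⟩ ht.2
    exact good_mono htt'.le ht'.2
  have hlim : ∀ t, ∃ y, t ∈ Ico 0 s → Tendsto (fun j => ξ j t) 𝒰 (𝓝 y) := fun t => by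
    by_cases ht : t ∈ Ico 0 s
    · obtain ⟨B, hB⟩ := good_lt t ht
      obtain ⟨y, -, hy⟩ := (isCompact_closedBall (0 : X) B).ultrafilter_le_nhds'
        (𝒰.map fun j => ξ j t) (hB.mono fun j hj => by simpa using hj t ⟨ht.1, le_rfl⟩)
      exact ⟨y, fun _ => hy⟩
    · exact ⟨0, fun h => absurd h ht⟩
  choose ζ hζ using hlim
  have hζsol := solvesConstInput_of_tendsto hF hu₀ hsT hsol good_lt hζ
  obtain ⟨ξ', heq, hξ'⟩ := (hc u₀ (ζ 0)).2 s ⟨hs0, hsT⟩ ζ rfl hζsol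
  obtain ⟨M, hM⟩ := isCompact_Icc.exists_bound_of_continuousOn hξ'.continuousOn
  obtain ⟨h, hh, hstep⟩ := good_step (M + 1)
  -- The extended limit solution is bounded by M on all of [0, T], so a start less than h before s,
  -- where the ξ j are eventually below M + 1, carries the common bound past s. Only s = T is then
  -- possible.
  obtain ⟨t₁, ht₁, ht₁s⟩ := exists_between (max_lt hs0 (sub_lt_self s hh))
  have ht₁m : t₁ ∈ Ico 0 s := ⟨(le_max_left _ _).trans ht₁.le, ht₁s⟩
  have ht₁T : t₁ ∈ Icc 0 T := ⟨ht₁m.1, ht₁s.le.trans hsT⟩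
  have hev : ∀ᶠ j in (𝒰 : Filter ℕ), ‖ξ j t₁‖ ≤ M + 1 := by
    have h1 : ‖ζ t₁‖ < M + 1 := by
      rw [← heq ht₁m]
      linarith [hM t₁ ht₁T]
    exact (hζ t₁ ht₁m).norm.eventually (ge_mem_nhds h1)
  have hg := hstep t₁ ht₁T (good_lt t₁ ht₁m) hev
  have hlt₁ : s < t₁ + h := by linarith [(le_max_right 0 (s - h)).trans_lt ht₁]
  have hmin : min (t₁ + h) T ≤ s :=
    le_csSup hSb ⟨⟨le_min (by linarith [ht₁m.1]) hT.le, min_le_right _ _⟩, hg⟩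
  have hTh : T < t₁ + h := by
    rcases min_le_iff.1 hmin with h' | h' <;> linarith
  rw [min_eq_right hTh.le] at hg
  obtain ⟨B, hB⟩ := hg
  have hlarge : ∀ᶠ j : ℕ in (𝒰 : Filter ℕ), B ≤ j :=
    (Nat.hyperfilter_le_atTop) (tendsto_natCast_atTop_atTop.eventually_ge_atTop B)
  obtain ⟨j, hj1, hj2⟩ := (hB.and hlarge).exists
  linarith [hj1 (t j) (ht j), hlt j]

end SampledDynamics

/-! ### Linear bounds over one period and the passage to continuous time -/

/-- Exponential decay at the sampling instants and a linear bound over one sampling period give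
exponential decay in continuous time. -/
theorem SampledTrajectory.norm_le_exp {X U : Type} [NormedAddCommGroup X] [NormedSpace ℝ X]
    {F : X → U → X} {μ : X → U} {T : ℝ} {ξ : ℝ → X} (h : SampledTrajectory F μ T ξ) (hT : 0 < T)
    {γ D D₁ : ℝ} (hγ : 0 ≤ γ) (hD : 0 ≤ D) (hD₁ : 0 ≤ D₁)
    (hsample : ∀ k : ℕ, ‖ξ (k * T)‖ ≤ D * Real.exp (-γ * (k * T)))
    (hper : ∀ (k : ℕ) (ζ : ℝ → X), ζ 0 = ξ (k * T) → SolvesConstInput F (μ (ζ 0)) (Icc 0 T) ζ →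
      ∀ t ∈ Icc 0 T, ‖ζ t‖ ≤ D₁ * ‖ζ 0‖) {t : ℝ} (ht : 0 ≤ t) :
    ‖ξ t‖ ≤ D₁ * D * Real.exp (γ * T) * Real.exp (-γ * t) := by
  set k := ⌊t / T⌋₊ with hk
  have hk1 : k * T ≤ t := by
    rw [← le_div_iff₀ hT]
    exact Nat.floor_le (div_nonneg ht hT.le)
  have hk2 : t ≤ (k + 1) * T := by
    rw [← div_le_iff₀ hT]
    exact (Nat.lt_floor_add_one _).le
  have hs := (h k).comp_add_const (k * T)
  rw [sub_self, add_mul, one_mul, add_sub_cancel_left] at hs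
  have := hper k (fun τ => ξ (τ + k * T)) (by simp) (by simpa using hs) (t - k * T)
    ⟨by linarith, by linarith⟩
  simp only [sub_add_cancel, zero_add] at this
  calc ‖ξ t‖ ≤ D₁ * ‖ξ (k * T)‖ := this
    _ ≤ D₁ * (D * Real.exp (-γ * (k * T))) := by gcongr; exact hsample k
    _ ≤ D₁ * (D * Real.exp (γ * T + -γ * t)) := by
        gcongr
        nlinarith
    _ = _ := by rw [Real.exp_add]; ring

/-- A locally Lipschitz map fixing zero is linearly bounded on bounded sets. -/
theorem LocallyLipschitz.exists_norm_le_mul {X Y : Type} [NormedAddCommGroup X] [ProperSpace X]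
    [NormedAddCommGroup Y] {Φ : X → Y} (h : LocallyLipschitz Φ) (h0 : Φ 0 = 0) (R : ℝ) :
    ∃ C : ℝ, 0 ≤ C ∧ ∀ x, ‖x‖ ≤ R → ‖Φ x‖ ≤ C * ‖x‖ := by
  obtain ⟨K, V, hV, hK⟩ := h 0
  obtain ⟨δ, hδ, hδV⟩ := Metric.mem_nhds_iff.1 hV
  obtain ⟨M, hM⟩ := (isCompact_closedBall (0 : X) R).exists_bound_of_continuousOn
    h.continuous.continuousOn
  refine ⟨max K (|M| / δ), le_max_of_le_left K.2, fun x hx => ?_⟩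
  rcases lt_or_ge ‖x‖ δ with hlt | hge
  · have := hK.norm_sub_le (hδV (by simpa using hlt)) (mem_of_mem_nhds hV)
    rw [h0, sub_zero, sub_zero] at this
    exact this.trans (by gcongr; exact le_max_left _ _)
  · calc ‖Φ x‖ ≤ |M| := (hM x (by simpa using hx)).trans (le_abs_self M)
      _ = |M| / δ * δ := (div_mul_cancel₀ _ hδ.ne').symm
      _ ≤ |M| / δ * ‖x‖ := by gcongr
      _ ≤ _ := by gcongr; exact le_max_right _ _

/-- Local linear growth, completeness and a linearly bounded feedback give a linear bound over one
sampling period, uniformly on bounded sets of initial values. -/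
theorem CompleteOverPeriod.exists_norm_le_mul {X U : Type} [NormedAddCommGroup X]
    [NormedSpace ℝ X] [ProperSpace X] [NormedAddCommGroup U] [ProperSpace U] {F : X → U → X}
    {T : ℝ} (hc : CompleteOverPeriod F T) (hT : 0 < T) (hF : Continuous fun p : X × U => F p.1 p.2)
    {δ K c : ℝ} (hδ : 0 < δ) (hK : 0 ≤ K) (hc0 : 0 ≤ c)
    (hgrowth : ∀ x u, ‖x‖ ≤ δ → ‖F x u‖ ≤ K * ‖x‖ + c * ‖u‖) {μ : X → U} {R Cμ : ℝ}
    (hCμ : 0 ≤ Cμ) (hμ : ∀ x, ‖x‖ ≤ R → ‖μ x‖ ≤ Cμ * ‖x‖) :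
    ∃ D : ℝ, 0 ≤ D ∧ ∀ ζ : ℝ → X, ‖ζ 0‖ ≤ R → SolvesConstInput F (μ (ζ 0)) (Icc 0 T) ζ →
      ∀ t ∈ Icc 0 T, ‖ζ t‖ ≤ D * ‖ζ 0‖ := by
  obtain ⟨B, hB⟩ := hc.exists_norm_le hT hF (max R (Cμ * R))
  set E := Real.exp ((K + 1) * (T - 0)) with hE
  have hE0 : 0 < E := Real.exp_pos _
  set D := (1 + c * Cμ) * E with hD
  have hD0 : 0 < D := by positivity
  -- If D‖ζ 0‖ < δ, Grönwall keeps the solution in the ball where the growth bound holds. Otherwise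
  -- ‖ζ 0‖ ≥ δ/D, and the compactness bound B is itself proportional to ‖ζ 0‖.
  refine ⟨max D (|B| * D / δ), le_max_of_le_left hD0.le, fun ζ hζ hsol t ht => ?_⟩
  have hu := hμ _ hζ
  have hle : (‖ζ 0‖ + c * ‖μ (ζ 0)‖) * E ≤ D * ‖ζ 0‖ := by
    calc (‖ζ 0‖ + c * ‖μ (ζ 0)‖) * E ≤ (‖ζ 0‖ + c * (Cμ * ‖ζ 0‖)) * E := by gcongr
      _ = _ := by rw [hD]; ring
  rcases lt_or_ge (D * ‖ζ 0‖) δ with hlt | hge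
  · refine (hsol.norm_le_exp hK (by positivity) (fun x hx => hgrowth x _ hx)
      (hle.trans_lt hlt) t ht).trans (hle.trans ?_)
    gcongr
    exact le_max_left _ _
  · have h1 : ‖ζ t‖ ≤ B := hB _ ζ (hu.trans ((mul_le_mul_of_nonneg_left hζ hCμ).trans
      (le_max_right _ _))) (hζ.trans (le_max_left _ _)) hsol t ht
    calc ‖ζ t‖ ≤ |B| := h1.trans (le_abs_self B)
      _ = |B| / δ * δ := (div_mul_cancel₀ _ hδ.ne').symm
      _ ≤ |B| / δ * (D * ‖ζ 0‖) := by gcongr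
      _ = |B| * D / δ * ‖ζ 0‖ := by ring
      _ ≤ _ := by gcongr; exact le_max_right _ _

/-- Global linear growth and a linearly bounded feedback give a linear bound over one sampling
period. -/
theorem SolvesConstInput.norm_le_mul_of_linear_growth {X U : Type} [NormedAddCommGroup X]
    [NormedSpace ℝ X] [NormedAddCommGroup U] {F : X → U → X} {u : U} {T K Cu : ℝ} {ζ : ℝ → X}
    (h : SolvesConstInput F u (Icc 0 T) ζ) (hK : 0 ≤ K)
    (hgrowth : ∀ x u, ‖F x u‖ ≤ K * (‖x‖ + ‖u‖)) (hu : ‖u‖ ≤ Cu * ‖ζ 0‖) :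
    ∀ t ∈ Icc 0 T, ‖ζ t‖ ≤ (1 + K * Cu) * Real.exp ((K + 1) * T) * ‖ζ 0‖ := fun t ht => by
  -- The growth bound is global, so any radius δ will do; `lt_add_one` fixes it as the estimate plus
  -- one.
  refine (h.norm_le_exp hK (mul_nonneg hK (norm_nonneg u)) (δ := _)
    (fun x _ => (hgrowth x u).trans_eq (mul_add _ _ _)) (lt_add_one _) t ht).trans ?_
  rw [sub_zero]
  calc (‖ζ 0‖ + K * ‖u‖) * Real.exp ((K + 1) * T) ≤
      (‖ζ 0‖ + K * (Cu * ‖ζ 0‖)) * Real.exp ((K + 1) * T) := by gcongr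
    _ = _ := by ring

/-- A continuous control-affine vector field with equilibrium at the origin whose drift is Lipschitz
near the origin has linear growth near the origin. -/
theorem exists_controlAffine_growth {n m : ℕ}
    {f : EuclideanSpace ℝ (Fin n) → EuclideanSpace ℝ (Fin n)}
    {g : Fin m → EuclideanSpace ℝ (Fin n) → EuclideanSpace ℝ (Fin n)} (hf0 : f 0 = 0)
    (hcont : Continuous fun p : EuclideanSpace ℝ (Fin n) × EuclideanSpace ℝ (Fin m) =>
      controlAffine f g p.1 p.2)
    (hLip : ∃ K, ∃ V ∈ 𝓝 (0 : EuclideanSpace ℝ (Fin n)),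
      LipschitzOnWith K (fun x => controlAffine f g x 0) V) :
    ∃ δ K c : ℝ, 0 < δ ∧ 0 ≤ K ∧ 0 ≤ c ∧
      ∀ x u, ‖x‖ ≤ δ → ‖controlAffine f g x u‖ ≤ K * ‖x‖ + c * ‖u‖ := by
  obtain ⟨K, V, hV, hK⟩ := hLip
  obtain ⟨δ, hδ, hδV⟩ := Metric.nhds_basis_closedBall.mem_iff.1 hV
  obtain ⟨M, hM0, hM⟩ := exists_norm_le_on_balls hcont (max δ 1)
  refine ⟨δ, K, 2 * M, hδ, K.2, by positivity, fun x u hx => ?_⟩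
  have h0 : ‖controlAffine f g x 0‖ ≤ K * ‖x‖ := by
    have := hK.norm_sub_le (hδV (by simpa using hx)) (mem_of_mem_nhds hV)
    simpa [controlAffine, hf0] using this
  have hv : ‖‖u‖⁻¹ • u‖ ≤ 1 := by
    rw [norm_smul, norm_inv, norm_norm]
    exact inv_mul_le_one
  have hu : u = ‖u‖ • ‖u‖⁻¹ • u := by
    rcases eq_or_ne u 0 with rfl | hne
    · simp
    · rw [smul_inv_smul₀ (norm_ne_zero_iff.2 hne)]
  -- Affinity in u reduces arbitrary inputs to the unit ball, where continuity gives the bound M.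
  have haff (s : ℝ) (v : EuclideanSpace ℝ (Fin m)) : controlAffine f g x (s • v) =
      controlAffine f g x 0 + s • (controlAffine f g x v - controlAffine f g x 0) := by
    simp [controlAffine, Finset.smul_sum, smul_smul]
  have hxM : ‖x‖ ≤ max δ 1 := hx.trans (le_max_left _ _)
  calc ‖controlAffine f g x u‖
      = ‖controlAffine f g x 0 + ‖u‖ • (controlAffine f g x (‖u‖⁻¹ • u)
          - controlAffine f g x 0)‖ := by rw [← haff, ← hu]
    _ ≤ K * ‖x‖ + ‖u‖ * (M + M) := by
        refine (norm_add_le _ _).trans (add_le_add h0 ?_)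
        rw [norm_smul, norm_norm]
        gcongr
        exact (norm_sub_le _ _).trans (add_le_add (hM _ _ hxM (hv.trans (le_max_right _ _)))
          (hM _ _ hxM (by simp)))
    _ = _ := by ring

/-! ### The sampled closed loop -/

theorem EuclideanSpace.norm_sq_eq_dotProduct {ι : Type} [Fintype ι] (x : EuclideanSpace ℝ ι) :
    ‖x‖ ^ 2 = x.ofLp ⬝ᵥ x.ofLp := by
  rw [EuclideanSpace.real_norm_sq_eq]
  exact Finset.sum_congr rfl fun i _ => sq _

/-- A vector is at most as long as any vector having it as a leading block. -/
theorem EuclideanSpace.norm_le_of_castLE {n N : ℕ} (hnN : n ≤ N) {x : EuclideanSpace ℝ (Fin n)}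
    {z : EuclideanSpace ℝ (Fin N)} (h : ∀ i, z (Fin.castLE hnN i) = x i) : ‖x‖ ≤ ‖z‖ := by
  refine (abs_le_of_sq_le_sq' ?_ (norm_nonneg z)).2
  rw [EuclideanSpace.real_norm_sq_eq, EuclideanSpace.real_norm_sq_eq]
  calc ∑ i, x i ^ 2 = ∑ i ∈ Finset.univ.map (Fin.castLEEmb hnN), z i ^ 2 := by
        simp [h]
    _ ≤ ∑ i, z i ^ 2 := Finset.sum_le_univ_sum_of_nonneg fun i => sq_nonneg _

/-- The feedback is bounded by a multiple of the lifted state. -/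
theorem exists_norm_rationalController_le {n m N α : ℕ} {A : Matrix (Fin N) (Fin N) ℝ}
    {B₀ : Matrix (Fin N) (Fin m) ℝ} {Bt : Matrix (Fin N) (Fin m × Fin N) ℝ} {cx cu : ℝ}
    {P : Matrix (Fin N) (Fin N) ℝ} {L : Matrix (Fin m) (Fin N) (MvPolynomial (Fin N) ℝ)}
    {τ ud : MvPolynomial (Fin N) ℝ} {ρ : ℝ} (hρ : 0 ≤ ρ)
    (h : IsSOSMatrix α (designMatrix A B₀ Bt cx cu P L τ ud ρ))
    (hτ : IsStrictlySOS α τ) (hud : IsStrictlySOS α ud) (hcu : 0 < cu)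
    (Φ : EuclideanSpace ℝ (Fin n) → EuclideanSpace ℝ (Fin N)) :
    ∃ C : ℝ, 0 ≤ C ∧ ∀ x, ‖rationalController Φ P L ud x‖ ≤ C * ‖Φ x‖ := by
  obtain ⟨C, hC, hL⟩ := exists_gain_bound hρ h hτ hud hcu
  obtain ⟨p, hp, hPinv⟩ := exists_quadForm_le (P⁻¹.transpose * P⁻¹)
  refine ⟨√(C * p), Real.sqrt_nonneg _, fun x => abs_le_of_sq_le_sq' ?_ (by positivity) |>.2⟩
  have hd := hud.eval_pos (Φ x).ofLp
  have h1 := hL (Φ x).ofLp (P⁻¹.mulVec (Φ x).ofLp)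
  have h2 := hPinv (Φ x).ofLp
  rw [← Matrix.mulVec_mulVec, Matrix.mulVec_transpose, dotProduct_comm,
    ← Matrix.dotProduct_mulVec] at h2
  rw [mul_pow, Real.sq_sqrt (by positivity), EuclideanSpace.norm_sq_eq_dotProduct,
    EuclideanSpace.norm_sq_eq_dotProduct]
  simp only [rationalController, smul_dotProduct, dotProduct_smul, smul_eq_mul]
  generalize MvPolynomial.eval (Φ x).ofLp ud = d at *
  calc _ ≤ 1 / d * (1 / d * (C * d ^ 2 * (p * ((Φ x).ofLp ⬝ᵥ (Φ x).ofLp)))) := by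
        gcongr
        exact h1.trans (by gcongr)
    _ = _ := by field_simp

/-- A quadratically bounded function contracting along a sequence forces exponential decay. -/
theorem exists_exp_decay_of_contraction {E : Type} [NormedAddCommGroup E] {V : E → ℝ}
    {a b q T : ℝ} (ha : 0 ≤ a) (hb : 0 ≤ b) (hq0 : 0 < q) (hq1 : q < 1) (hT : 0 < T)
    (hVa : ∀ z, ‖z‖ ^ 2 ≤ a * V z) (hVb : ∀ z, V z ≤ b * ‖z‖ ^ 2) :
    ∃ γ : ℝ, 0 < γ ∧ ∃ C : ℝ, 0 ≤ C ∧ ∀ z : ℕ → E, (∀ k, V (z (k + 1)) ≤ q * V (z k)) →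
      ∀ k : ℕ, ‖z k‖ ≤ C * Real.exp (-γ * (k * T)) * ‖z 0‖ := by
  -- V is quadratic in the norm, so the norm decays at half the rate of V.
  refine ⟨-Real.log q / (2 * T), div_pos (neg_pos.2 (Real.log_neg hq0 hq1)) (by positivity),
    √(a * b), Real.sqrt_nonneg _, fun z hz k => (abs_le_of_sq_le_sq' ?_ (by positivity)).2⟩
  have hV : V (z k) ≤ q ^ k * V (z 0) := by
    induction k with
    | zero => simp
    | succ k ih =>
      calc V (z (k + 1)) ≤ q * V (z k) := hz k
        _ ≤ q * (q ^ k * V (z 0)) := by gcongr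
        _ = _ := by ring
  have hexp : Real.exp (-(-Real.log q / (2 * T)) * (k * T)) ^ 2 = q ^ k := by
    rw [← Real.exp_nat_mul, ← Real.rpow_natCast q k, Real.rpow_def_of_pos hq0]
    congr 1
    push_cast
    field_simp
  rw [mul_pow, mul_pow, hexp, Real.sq_sqrt (by positivity)]
  calc ‖z k‖ ^ 2 ≤ a * V (z k) := hVa _
    _ ≤ a * (q ^ k * (b * ‖z 0‖ ^ 2)) := by
        gcongr
        exact hV.trans (by gcongr; exact hVb _)
    _ = _ := by ring

/-- The Lyapunov function `zᵀ P⁻¹ z` contracts along the sampled closed loop. -/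
theorem exists_lyapunov_contraction {n m N α : ℕ} {A : Matrix (Fin N) (Fin N) ℝ}
    {B₀ : Matrix (Fin N) (Fin m) ℝ} {Bt : Matrix (Fin N) (Fin m × Fin N) ℝ} {cx cu : ℝ}
    {P : Matrix (Fin N) (Fin N) ℝ} {L : Matrix (Fin m) (Fin N) (MvPolynomial (Fin N) ℝ)}
    {τ ud : MvPolynomial (Fin N) ℝ} {ρ : ℝ}
    (h : IsSOSMatrix α (designMatrix A B₀ Bt cx cu P L τ ud ρ)) (hP : P.PosDef)
    (hτ : IsStrictlySOS α τ) (hud : IsStrictlySOS α ud) (hcx : 0 < cx) (hcu : 0 < cu)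
    (hρ : 0 < ρ) (Φ : EuclideanSpace ℝ (Fin n) → EuclideanSpace ℝ (Fin N))
    {r : EuclideanSpace ℝ (Fin n) → EuclideanSpace ℝ (Fin m) → EuclideanSpace ℝ (Fin N)}
    (hbound : ∀ x u, ‖r x u‖ ≤ cx * ‖Φ x‖ + cu * ‖u‖) :
    ∃ q : ℝ, 0 < q ∧ q < 1 ∧ ∀ x y, Φ y = bilinearModel A B₀ Bt (Φ x) (rationalController Φ P L ud x)
        + r x (rationalController Φ P L ud x) →
      (Φ y).ofLp ⬝ᵥ P⁻¹.mulVec (Φ y).ofLp ≤ q * ((Φ x).ofLp ⬝ᵥ P⁻¹.mulVec (Φ x).ofLp) := by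
  obtain ⟨p, hp, hPp⟩ := exists_quadForm_le P
  -- With w = P⁻¹z, V = wᵀPw ≤ (p + ρ)|w|², so the decrease ρ|w|² is at least the fraction ρ/(p + ρ)
  -- of V; enlarging p to p + ρ keeps the factor positive.
  refine ⟨1 - ρ / (p + ρ), ?_, by linarith [div_pos hρ (add_pos hp hρ)], fun x y hxy => ?_⟩
  · rw [sub_pos, div_lt_one (by positivity)]
    linarith
  set z := (Φ x).ofLp with hz
  have hr : (r x (rationalController Φ P L ud x)).ofLp ⬝ᵥ
      (r x (rationalController Φ P L ud x)).ofLp ≤ 2 * cx ^ 2 * (z ⬝ᵥ z) + 2 * cu ^ 2 *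
        ((rationalController Φ P L ud x).ofLp ⬝ᵥ (rationalController Φ P L ud x).ofLp) := by
    rw [hz]
    simp only [← EuclideanSpace.norm_sq_eq_dotProduct]
    -- From (x + y)² ≤ 2x² + 2y²; this is the origin of the factors 2 in the design matrix.
    have h1 := pow_le_pow_left₀ (norm_nonneg _) (hbound x (rationalController Φ P L ud x)) 2
    nlinarith [sq_nonneg (cx * ‖Φ x‖ - cu * ‖rationalController Φ P L ud x‖)]
  have hdec := lyapunov_decrease h hP hτ hud hcx hcu (z := z) (zp := (Φ y).ofLp) rfl
    (by rw [hxy]; rfl) hr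
  set w := P⁻¹.mulVec z with hw
  have hV : z ⬝ᵥ w ≤ (p + ρ) * (w ⬝ᵥ w) := by
    have hPw : P.mulVec w = z := hP.mulVec_inv_mulVec z
    have hww : 0 ≤ w ⬝ᵥ w := Finset.sum_nonneg fun i _ => mul_self_nonneg _
    have := hPp w
    rw [hPw, dotProduct_comm] at this
    nlinarith
  have : ρ / (p + ρ) * (z ⬝ᵥ w) ≤ ρ * (w ⬝ᵥ w) := by
    rw [div_mul_eq_mul_div, div_le_iff₀ (by positivity)]
    nlinarith
  linarith

/-! ### The stabilization theorem -/

theorem corollary1 {n m N : ℕ}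
    -- the control-affine system
    (f : EuclideanSpace ℝ (Fin n) → EuclideanSpace ℝ (Fin n))
    (g : Fin m → EuclideanSpace ℝ (Fin n) → EuclideanSpace ℝ (Fin n))
    (hf0 : f 0 = 0)
    (hcont : Continuous fun p : EuclideanSpace ℝ (Fin n) × EuclideanSpace ℝ (Fin m) =>
      controlAffine f g p.1 p.2)
    (hLip : ∀ u, ∃ K, ∃ V ∈ 𝓝 (0 : EuclideanSpace ℝ (Fin n)),
      LipschitzOnWith K (fun x => controlAffine f g x u) V)
    -- the sampling period, over which the sampled dynamics are defined
    (T : ℝ) (hT : 0 < T) (hcomplete : CompleteOverPeriod (controlAffine f g) T)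
    -- the lifting, whose first `n` components are the state
    (hnN : n ≤ N) (Φ : EuclideanSpace ℝ (Fin n) → EuclideanSpace ℝ (Fin N))
    (hΦstate : ∀ x i, Φ x (Fin.castLE hnN i) = x i) (hΦLip : LocallyLipschitz Φ)
    -- the lifted bilinear surrogate model and the proportional bound on its residual
    (A : Matrix (Fin N) (Fin N) ℝ) (B₀ : Matrix (Fin N) (Fin m) ℝ)
    (Bt : Matrix (Fin N) (Fin m × Fin N) ℝ)
    (r : EuclideanSpace ℝ (Fin n) → EuclideanSpace ℝ (Fin m) → EuclideanSpace ℝ (Fin N))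
    (hmodel : ∀ (u : EuclideanSpace ℝ (Fin m)) (ξ : ℝ → EuclideanSpace ℝ (Fin n)),
      SolvesConstInput (controlAffine f g) u (Icc 0 T) ξ →
        Φ (ξ T) = bilinearModel A B₀ Bt (Φ (ξ 0)) u + r (ξ 0) u)
    (cx cu : ℝ) (hcx : 0 < cx) (hcu : 0 < cu)
    (hbound : ∀ x u, ‖r x u‖ ≤ cx * ‖Φ x‖ + cu * ‖u‖)
    -- feasibility of the SOS condition
    (α : ℕ) (hα : 0 < α) (P : Matrix (Fin N) (Fin N) ℝ) (hP : P.PosDef)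
    (L : Matrix (Fin m) (Fin N) (MvPolynomial (Fin N) ℝ))
    (hL : ∀ i j, (L i j).totalDegree ≤ 2 * α - 1)
    (τ ud : MvPolynomial (Fin N) ℝ) (hτ : IsStrictlySOS α τ) (hud : IsStrictlySOS α ud)
    (ρ : ℝ) (hρ : 0 < ρ)
    (hSOS : IsSOSMatrix α (designMatrix A B₀ Bt cx cu P L τ ud ρ)) :
    -- the closed loop has a trajectory from every initial state
    (∀ x₀, ∃ ξ, ξ 0 = x₀ ∧
      SampledTrajectory (controlAffine f g) (rationalController Φ P L ud) T ξ) ∧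
    ∃ γ : ℝ, 0 < γ ∧
      -- exponential decay of the sampled lifted state, uniformly in all trajectories
      (∃ C : ℝ, ∀ ξ, SampledTrajectory (controlAffine f g) (rationalController Φ P L ud) T ξ →
        ∀ k : ℕ, ‖Φ (ξ (k * T))‖ ≤ C * Real.exp (-γ * (k * T)) * ‖Φ (ξ 0)‖) ∧
      -- exponential stability in continuous time: the rate is global, the overshoot constant is
      -- uniform on each bounded set of initial states
      (∀ R : ℝ, ∃ C : ℝ,
        ∀ ξ, SampledTrajectory (controlAffine f g) (rationalController Φ P L ud) T ξ →
          ‖ξ 0‖ ≤ R → ∀ t : ℝ, 0 ≤ t → ‖ξ t‖ ≤ C * Real.exp (-γ * t) * ‖ξ 0‖) ∧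
      -- under linear growth of the lifting and of the vector field the overshoot constant is global
      ((∃ ℓ : ℝ, (∀ x, ‖Φ x‖ ≤ ℓ * ‖x‖) ∧
          ∀ x u, ‖controlAffine f g x u‖ ≤ ℓ * (‖x‖ + ‖u‖)) →
        ∃ C : ℝ, ∀ ξ, SampledTrajectory (controlAffine f g) (rationalController Φ P L ud) T ξ →
          ∀ t : ℝ, 0 ≤ t → ‖ξ t‖ ≤ C * Real.exp (-γ * t) * ‖ξ 0‖) := by
  set μ := rationalController Φ P L ud with hμdef
  have hexist := hcomplete.exists_sampledTrajectory hT μ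
  refine ⟨hexist, ?_⟩
  obtain ⟨q, hq0, hq1, hq⟩ := exists_lyapunov_contraction hSOS hP hτ hud hcx hcu hρ Φ hbound
  obtain ⟨p, hp, hPp⟩ := exists_quadForm_le P
  obtain ⟨p', hp', hPp'⟩ := exists_quadForm_le P⁻¹
  obtain ⟨γ, hγ, C, hC, hdecay⟩ := exists_exp_decay_of_contraction
    (V := fun z : EuclideanSpace ℝ (Fin N) => z.ofLp ⬝ᵥ P⁻¹.mulVec z.ofLp) hp.le hp'.le hq0 hq1 hT
    (fun z => by
      rw [EuclideanSpace.norm_sq_eq_dotProduct]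
      exact hP.dotProduct_self_le_inv_quadForm hp hPp _)
    (fun z => by
      rw [EuclideanSpace.norm_sq_eq_dotProduct]
      exact hPp' _)
  have hsample : ∀ ξ, SampledTrajectory (controlAffine f g) μ T ξ →
      ∀ k : ℕ, ‖Φ (ξ (k * T))‖ ≤ C * Real.exp (-γ * (k * T)) * ‖Φ (ξ 0)‖ := by
    intro ξ hξ k
    have := hdecay (fun k => Φ (ξ (k * T))) (fun k => hq _ _ ?_) k
    · simpa using this
    have hs := (hξ k).comp_add_const (k * T)
    rw [sub_self, add_mul, one_mul, add_sub_cancel_left] at hs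
    have := hmodel _ _ hs
    rw [zero_add, show T + (k : ℝ) * T = ((k + 1 : ℕ) : ℝ) * T by push_cast; ring] at this
    exact this
  have hexp_le (k : ℕ) : Real.exp (-γ * (k * T)) ≤ 1 :=
    Real.exp_le_one_iff.2 (by
      rw [neg_mul, neg_nonpos]
      positivity)
  have hnorm (x : EuclideanSpace ℝ (Fin n)) : ‖x‖ ≤ ‖Φ x‖ :=
    EuclideanSpace.norm_le_of_castLE hnN (hΦstate x)
  -- Along a trajectory from 0 the samples of Φ(ξ) tend to 0, hence so do those of ξ, and continuity
  -- of Φ at 0 identifies the limit as Φ(0).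
  have hΦ0 : Φ 0 = 0 := by
    obtain ⟨ξ, hξ0, hξ⟩ := hexist 0
    have hlim : Tendsto (fun k : ℕ => Φ (ξ (k * T))) atTop (𝓝 0) := by
      refine squeeze_zero_norm (hsample ξ hξ) ?_
      have h1 : Tendsto (fun k : ℕ => -γ * ((k : ℝ) * T)) atTop atBot :=
        (tendsto_natCast_atTop_atTop.atTop_mul_const hT).const_mul_atTop_of_neg (neg_neg_of_pos hγ)
      simpa using ((Real.tendsto_exp_atBot.comp h1).const_mul C).mul_const ‖Φ (ξ 0)‖
    have hlim' : Tendsto (fun k : ℕ => ξ (k * T)) atTop (𝓝 0) :=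
      squeeze_zero_norm (fun k => hnorm _) (by simpa using hlim.norm)
    exact tendsto_nhds_unique ((hΦLip.continuous.tendsto 0).comp hlim') hlim
  obtain ⟨Cμ, hCμ, hμ⟩ := exists_norm_rationalController_le hρ.le hSOS hτ hud hcu Φ
  refine ⟨γ, hγ, ⟨C, hsample⟩, fun R => ?_, ?_⟩
  · obtain ⟨CΦ, hCΦ, hΦ⟩ := hΦLip.exists_norm_le_mul hΦ0 R
    -- All samples of a trajectory starting in the R-ball lie in the R'-ball, so the bound over one
    -- period must be uniform there.
    set R' := C * (CΦ * |R|) with hR'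
    obtain ⟨CΦ', hCΦ', hΦ'⟩ := hΦLip.exists_norm_le_mul hΦ0 R'
    obtain ⟨δ, K, c, hδ, hK, hc, hgrowth⟩ := exists_controlAffine_growth hf0 hcont (hLip 0)
    obtain ⟨D, hD, hper⟩ := hcomplete.exists_norm_le_mul hT hcont hδ hK hc hgrowth (μ := μ) (R := R')
      (mul_nonneg hCμ hCΦ') (fun x hx => (hμ x).trans (by
        rw [mul_assoc]
        exact mul_le_mul_of_nonneg_left (hΦ' x hx) hCμ))
    refine ⟨D * (C * CΦ) * Real.exp (γ * T), fun ξ hξ hξR t ht => ?_⟩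
    have hs (k : ℕ) : ‖ξ (k * T)‖ ≤ C * CΦ * ‖ξ 0‖ * Real.exp (-γ * (k * T)) := by
      calc ‖ξ (k * T)‖ ≤ C * Real.exp (-γ * (k * T)) * ‖Φ (ξ 0)‖ :=
            (hnorm _).trans (hsample ξ hξ k)
        _ ≤ C * Real.exp (-γ * (k * T)) * (CΦ * ‖ξ 0‖) := by
            gcongr
            exact hΦ _ hξR
        _ = _ := by ring
    have hsR (k : ℕ) : ‖ξ (k * T)‖ ≤ R' := by
      calc ‖ξ (k * T)‖ ≤ C * CΦ * ‖ξ 0‖ * Real.exp (-γ * (k * T)) := hs k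
        _ ≤ C * CΦ * ‖ξ 0‖ * 1 := by
            gcongr
            exact hexp_le k
        _ ≤ C * CΦ * |R| * 1 := by
            gcongr
            exact hξR.trans (le_abs_self R)
        _ = R' := by rw [hR']; ring
    refine (hξ.norm_le_exp hT hγ.le (by positivity) hD hs
      (fun k ζ hζ => hper ζ (by rw [hζ]; exact hsR k)) ht).trans_eq (by ring)
  · rintro ⟨ℓ, hΦℓ, hFℓ⟩
    have hΦ (x : EuclideanSpace ℝ (Fin n)) : ‖Φ x‖ ≤ |ℓ| * ‖x‖ :=
      (hΦℓ x).trans (by gcongr; exact le_abs_self ℓ)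
    set D := (1 + |ℓ| * (Cμ * |ℓ|)) * Real.exp ((|ℓ| + 1) * T) with hD
    refine ⟨D * (C * |ℓ|) * Real.exp (γ * T), fun ξ hξ t ht => ?_⟩
    have hs (k : ℕ) : ‖ξ (k * T)‖ ≤ C * |ℓ| * ‖ξ 0‖ * Real.exp (-γ * (k * T)) := by
      calc ‖ξ (k * T)‖ ≤ C * Real.exp (-γ * (k * T)) * ‖Φ (ξ 0)‖ :=
            (hnorm _).trans (hsample ξ hξ k)
        _ ≤ C * Real.exp (-γ * (k * T)) * (|ℓ| * ‖ξ 0‖) := by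
            gcongr
            exact hΦ _
        _ = _ := by ring
    refine (hξ.norm_le_exp hT hγ.le (by positivity) (by positivity : 0 ≤ D) hs
      (fun k ζ _ hsol => hsol.norm_le_mul_of_linear_growth (abs_nonneg ℓ)
        (fun x u => (hFℓ x u).trans (by gcongr; exact le_abs_self ℓ)) ?_) ht).trans_eq (by ring)
    rw [mul_assoc]
    exact (hμ _).trans (mul_le_mul_of_nonneg_left (hΦ _) hCμ)
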